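/- Let $\mathcal X$ and $\mathcal Y$ be finite-dimensional Hausdorff paracompact smooth ($C^\infty$) real manifolds (boundary and corners are allowed, but not required), and let $p_E : E \to \mathcal X\times\mathcal Y$ be a smooth real or complex vector bundle of finite rank. If $\mathcal X$ is contractible, then $E$ is trivial with respect to $\mathcal X$: there exist a smooth vector bundle $p_F : F \to \mathcal Y$ (over the same field and of the same rank) and an isomorphism of smooth vector bundles over the identity of $\mathcal X\times\mathcal Y$ between $E$ and the product bundle $\mathrm{Id}_{\mathcal X}\times p_F : \mathcal X\times F\to\mathcal X\times\mathcal Y$, that is, a diffeomorphism $f : E\to\mathcal X\times F$ which maps each fibre $E_{(x,y)}$ by a linear isomorphism onto $\{x\}\times F_y$. (Equivalently, $E$ is isomorphic to the pullback of $F$ under the second projection $\mathcal X\times\mathcal Y\to\mathcal Y$.) -/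

import Mathlib

universe w

open scoped Manifold ContDiff Bundle

/-- A smooth `𝕜`-vector bundle (`𝕜 = ℝ` or `ℂ`) with typical fibre `V` over a real smooth manifold
`M` with model `I`: a family of `𝕜`-vector spaces over the points of `M`, together with a topology
on the total space and an atlas of local trivializations which are fibrewise `𝕜`-linear and whose
transition maps are smooth. The real vector space structures on the fibres are the restrictions of
the `𝕜`-linear ones; they are there because smoothness over the real manifold `M` is real
smoothness. -/
structure SmoothVectorBundle (𝕜 : Type*) [RCLike 𝕜]
    (V : Type*) [NormedAddCommGroup V] [NormedSpace ℝ V] [NormedSpace 𝕜 V]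
    {B H : Type*} [NormedAddCommGroup B] [NormedSpace ℝ B] [TopologicalSpace H]
    (I : ModelWithCorners ℝ B H)
    (M : Type*) [TopologicalSpace M] [ChartedSpace H M] where
  /-- The fibres. -/
  Fiber : M → Type w
  [addCommGroup : ∀ x, AddCommGroup (Fiber x)]
  [module : ∀ x, Module 𝕜 (Fiber x)]
  [realModule : ∀ x, Module ℝ (Fiber x)]
  [isScalarTower : ∀ x, IsScalarTower ℝ 𝕜 (Fiber x)]
  [topologicalSpaceFiber : ∀ x, TopologicalSpace (Fiber x)]
  [topologicalSpaceTotal : TopologicalSpace (Bundle.TotalSpace V Fiber)]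
  [fiberBundle : FiberBundle V Fiber]
  [vectorBundle : VectorBundle 𝕜 V Fiber]
  [realVectorBundle : VectorBundle ℝ V Fiber]
  [contMDiffVectorBundle : ContMDiffVectorBundle ∞ V Fiber I]

namespace SmoothVectorBundle

attribute [instance] addCommGroup module realModule isScalarTower topologicalSpaceFiber
  topologicalSpaceTotal fiberBundle vectorBundle realVectorBundle contMDiffVectorBundle

/-- The total space of a smooth vector bundle (a smooth manifold modelled on `I.prod 𝓘(ℝ, V)`). -/
abbrev Total {𝕜 : Type*} [RCLike 𝕜]
    {V : Type*} [NormedAddCommGroup V] [NormedSpace ℝ V] [NormedSpace 𝕜 V]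
    {B H : Type*} [NormedAddCommGroup B] [NormedSpace ℝ B] [TopologicalSpace H]
    {I : ModelWithCorners ℝ B H}
    {M : Type*} [TopologicalSpace M] [ChartedSpace H M]
    (E : SmoothVectorBundle 𝕜 V I M) : Type _ :=
  Bundle.TotalSpace V E.Fiber

/-- A semi-trivialization of a bundle `E` over `X × Y`: an isomorphism `f` of smooth vector bundles
over the identity of `X × Y` between `E` and the bundle `Id × p_F : X × F → X × Y`, where
`p_F : F → Y` is a smooth vector bundle. That is, `f` is a diffeomorphism of total spaces which maps
the fibre of `E` over `(x, y)` to `{x} × F_y` by a `𝕜`-linear isomorphism. -/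
structure SemiTrivialization {𝕜 : Type*} [RCLike 𝕜]
    {V : Type*} [NormedAddCommGroup V] [NormedSpace ℝ V] [NormedSpace 𝕜 V]
    {BX HX : Type*} [NormedAddCommGroup BX] [NormedSpace ℝ BX] [TopologicalSpace HX]
    {IX : ModelWithCorners ℝ BX HX}
    {X : Type*} [TopologicalSpace X] [ChartedSpace HX X]
    {BY HY : Type*} [NormedAddCommGroup BY] [NormedSpace ℝ BY] [TopologicalSpace HY]
    {IY : ModelWithCorners ℝ BY HY}
    {Y : Type*} [TopologicalSpace Y] [ChartedSpace HY Y]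
    (E : SmoothVectorBundle 𝕜 V (IX.prod IY) (X × Y)) (F : SmoothVectorBundle 𝕜 V IY Y) where
  /-- The diffeomorphism between the total spaces. -/
  toDiffeomorph : Diffeomorph ((IX.prod IY).prod 𝓘(ℝ, V)) (IX.prod (IY.prod 𝓘(ℝ, V)))
    E.Total (X × F.Total) ∞
  /-- The linear isomorphisms between the fibres. -/
  fiberEquiv : ∀ p : X × Y, E.Fiber p ≃ₗ[𝕜] F.Fiber p.2
  map_mk : ∀ (p : X × Y) (v : E.Fiber p), toDiffeomorph ⟨p, v⟩ = (p.1, ⟨p.2, fiberEquiv p v⟩)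

/-- A smooth vector bundle `E` over `X × Y` is trivial with respect to `X` if it admits a
semi-trivialization `E ≅ X × F` for some smooth vector bundle `F` over `Y`. -/
def IsTrivialWithRespectToFst
    {𝕜 : Type*} [RCLike 𝕜]
    {V : Type*} [NormedAddCommGroup V] [NormedSpace ℝ V] [NormedSpace 𝕜 V]
    {BX HX : Type*} [NormedAddCommGroup BX] [NormedSpace ℝ BX] [TopologicalSpace HX]
    {IX : ModelWithCorners ℝ BX HX}
    {X : Type*} [TopologicalSpace X] [ChartedSpace HX X]
    {BY HY : Type*} [NormedAddCommGroup BY] [NormedSpace ℝ BY] [TopologicalSpace HY]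
    {IY : ModelWithCorners ℝ BY HY}
    {Y : Type*} [TopologicalSpace Y] [ChartedSpace HY Y]
    (E : SmoothVectorBundle.{w} 𝕜 V (IX.prod IY) (X × Y)) : Prop :=
  ∃ F : SmoothVectorBundle.{w} 𝕜 V IY Y, Nonempty (SemiTrivialization E F)

end SmoothVectorBundle

-- A contraction of `X` to `x₀` gives a homotopy `c` on `M = X × Y` from the identity to `r (x, y) =
-- (x₀, y)`, and it suffices to identify the fibres `E_p` and `E_{r p}` smoothly in `p`: then `E ≅ X
-- × F`, with `F` the pullback of `E` under `y ↦ (x₀, y)`.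
--
-- The contraction is only continuous, so a discrete substitute replaces parallel transport. A
-- partition of unity on `M × M` gives linear maps `T p q : E_p → E_q`, continuous in `(p, q)` and
-- equal to the identity on the diagonal, hence injective near it
-- (`exists_continuousHomAt_eq_id_on_diagonal`). Composing them along `s ↦ c s p` with a small step
-- `δ p`, continuous in `p`, yields continuous injective maps `E_p → E_{r p}`
-- (`exists_continuousHomAt_injective_of_homotopy`).
--
-- Since `r` is smooth, this family can be approximated by a smooth one: lying close to it is a
-- convex condition on each fibre, so local approximations glue, and closeness forces injectivity
-- (`exists_contMDiffHomAt_injective_of_continuousHomAt`). Equality of ranks makes the maps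
-- bijective, and smoothness of inversion makes the inverse family smooth.

universe uX

open Set Filter Topology Bundle

/-! ### Locally compact paracompact spaces: products and refinements. -/

section Topology

theorem exists_locallyFinite_isOpen_isCompact_closure (X : Type*) [TopologicalSpace X] [T2Space X]
    [ParacompactSpace X] [LocallyCompactSpace X] :
    ∃ v : X → Set X, (∀ x, IsOpen (v x)) ∧ (⋃ x, v x) = univ ∧ LocallyFinite v ∧
      ∀ x, IsCompact (closure (v x)) := by
  choose K hK hxK using fun x : X => exists_compact_mem_nhds x
  obtain ⟨v, hvo, hvU, hvf, hvK⟩ := precise_refinement (fun x => interior (K x))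
    (fun x => isOpen_interior) (iUnion_eq_univ_iff.2 fun x => ⟨x, mem_interior_iff_mem_nhds.2 (hxK x)⟩)
  exact ⟨v, hvo, hvU, hvf, fun x => (hK x).of_isClosed_subset isClosed_closure
    (closure_minimal ((hvK x).trans interior_subset) (hK x).isClosed)⟩

theorem LocallyFinite.sigma_of_subset {X ι : Type*} [TopologicalSpace X] {v : ι → Set X}
    (hv : LocallyFinite v) {κ : ι → Type*} [∀ i, Finite (κ i)] {u : (Σ i, κ i) → Set X}
    (hu : ∀ a, u a ⊆ v a.1) : LocallyFinite u := by
  intro x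
  obtain ⟨W, hW, hfin⟩ := hv x
  refine ⟨W, hW, (hfin.preimage' (f := Sigma.fst) fun i _ =>
    (finite_range (Sigma.mk (β := κ) i)).subset ?_).subset ?_⟩
  · rintro ⟨_, k⟩ rfl
    exact mem_range_self k
  · rintro ⟨i, k⟩ ⟨y, hy, hyW⟩
    exact ⟨y, hu _ hy, hyW⟩

/-- Each compact `closure (v i)` meets the need with finitely many members of a given cover; cutting
these down to `v i` gives a refinement whose local finiteness is inherited from `v`. -/
theorem ParacompactSpace.of_locallyFinite_isCompact_closure {X : Type*} {ι : Type*}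
    [TopologicalSpace X] {v : ι → Set X} (hvo : ∀ i, IsOpen (v i)) (hvU : (⋃ i, v i) = univ)
    (hvf : LocallyFinite v) (hvc : ∀ i, IsCompact (closure (v i))) : ParacompactSpace X := by
  refine ⟨fun α s ho hs => ?_⟩
  choose t ht using fun i => (hvc i).elim_finite_subcover s ho (by simp [hs])
  let u : (Σ i, t i) → Set X := fun a => v a.1 ∩ s a.2
  have hlf : LocallyFinite u := hvf.sigma_of_subset fun a => inter_subset_left
  refine ⟨range u, fun a => a.1, ?_, ?_, hlf.on_range, ?_⟩
  · rintro ⟨_, a, rfl⟩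
    exact (hvo _).inter (ho _)
  · refine iUnion_eq_univ_iff.2 fun x => ?_
    obtain ⟨i, hi⟩ := iUnion_eq_univ_iff.1 hvU x
    obtain ⟨j, hj, hxj⟩ := mem_iUnion₂.1 (ht i (subset_closure hi))
    exact ⟨⟨_, ⟨⟨i, j, hj⟩, rfl⟩⟩, hi, hxj⟩
  · rintro ⟨_, a, rfl⟩
    exact ⟨_, inter_subset_right⟩

/-- Paracompactness is not stable under products in general; local compactness supplies product
covers by relatively compact sets. This allows partitions of unity on `X × Y` and on its square. -/
theorem ParacompactSpace.prod_of_locallyCompact (X Y : Type*) [TopologicalSpace X] [T2Space X]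
    [ParacompactSpace X] [LocallyCompactSpace X] [TopologicalSpace Y] [T2Space Y]
    [ParacompactSpace Y] [LocallyCompactSpace Y] : ParacompactSpace (X × Y) := by
  obtain ⟨v, hvo, hvU, hvf, hvc⟩ := exists_locallyFinite_isOpen_isCompact_closure X
  obtain ⟨u, huo, huU, huf, huc⟩ := exists_locallyFinite_isOpen_isCompact_closure Y
  refine .of_locallyFinite_isCompact_closure (v := fun a : X × Y => v a.1 ×ˢ u a.2)
    (fun a => (hvo _).prod (huo _)) ?_ ?_ fun a => ?_
  · refine iUnion_eq_univ_iff.2 fun x => ?_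
    obtain ⟨i, hi⟩ := iUnion_eq_univ_iff.1 hvU x.1
    obtain ⟨j, hj⟩ := iUnion_eq_univ_iff.1 huU x.2
    exact ⟨(i, j), hi, hj⟩
  · intro x
    obtain ⟨W, hW, hWf⟩ := hvf x.1
    obtain ⟨W', hW', hWf'⟩ := huf x.2
    refine ⟨W ×ˢ W', prod_mem_nhds hW hW', (hWf.prod hWf').subset ?_⟩
    rintro ⟨i, j⟩ ⟨y, ⟨h1, h2⟩, h3, h4⟩
    exact ⟨⟨_, h1, h3⟩, ⟨_, h2, h4⟩⟩
  · rw [closure_prod_eq]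
    exact (hvc _).prod (huc _)

theorem refinement_of_locallyCompact_paracompact_of_nhds_basis_set {X : Type uX} [TopologicalSpace X]
    [T2Space X] [ParacompactSpace X] [LocallyCompactSpace X] {ι : X → Type*}
    {p : ∀ x, ι x → Prop} {B : ∀ x, ι x → Set X} {s : Set X} (hs : IsClosed s)
    (hB : ∀ x ∈ s, (𝓝 x).HasBasis (p x) (B x)) :
    ∃ (α : Type uX) (c : α → X) (r : ∀ a, ι (c a)), (∀ a, c a ∈ s ∧ p (c a) (r a)) ∧
      (s ⊆ ⋃ a, B (c a) (r a)) ∧ LocallyFinite fun a => B (c a) (r a) := by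
  obtain ⟨v, hvo, hvU, hvf, hvc⟩ := exists_locallyFinite_isOpen_isCompact_closure X
  -- The shrunken sets `C x` meet `s` in compact sets, each covered by finitely many basic sets
  -- inside `v x`; local finiteness of `v` then passes to all of them together.
  obtain ⟨C, hCU, hCc, hCv⟩ := exists_iUnion_eq_closed_subset hvo hvf.point_finite hvU
  have hcomp : ∀ x, IsCompact (C x ∩ s) := fun x =>
    (hvc x).of_isClosed_subset ((hCc x).inter hs)
      (inter_subset_left.trans ((hCv x).trans subset_closure))
  choose r hr hrv using fun (x : X) (z : X) (hz : z ∈ C x ∩ s) =>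
    (hB z hz.2).mem_iff.1 ((hvo x).mem_nhds (hCv x hz.1))
  choose t ht using fun x => (hcomp x).elim_nhds_subcover' (fun z hz => B z (r x z hz))
    fun z hz => (hB z hz.2).mem_of_mem (hr x z hz)
  refine ⟨Σ x, t x, fun a => a.2.1, fun a => r a.1 _ a.2.1.2, fun a => ⟨a.2.1.2.2, hr _ _ _⟩, ?_,
    hvf.sigma_of_subset fun a => hrv _ _ _⟩
  intro z hz
  obtain ⟨x, hx⟩ := iUnion_eq_univ_iff.1 hCU z
  obtain ⟨y, hy, hzy⟩ := mem_iUnion₂.1 (ht x ⟨hx, hz⟩)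
  exact mem_iUnion.2 ⟨⟨x, y, hy⟩, hzy⟩

end Topology

/-! ### Smooth partitions of unity on paracompact manifolds. -/

section Partition

variable {B H : Type*} [NormedAddCommGroup B] [NormedSpace ℝ B] [FiniteDimensional ℝ B]
  [TopologicalSpace H] (I : ModelWithCorners ℝ B H) {M : Type uX} [TopologicalSpace M]
  [ChartedSpace H M] [IsManifold I ∞ M] [T2Space M] [ParacompactSpace M]

omit [IsManifold I ∞ M] in
theorem SmoothBumpCovering.exists_isSubordinate_of_paracompact {s : Set M} {U : M → Set M}
    (hs : IsClosed s) (hU : ∀ x ∈ s, U x ∈ 𝓝 x) :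
    ∃ (ι : Type uX) (f : SmoothBumpCovering ι I M s), f.IsSubordinate U := by
  have : LocallyCompactSpace H := I.locallyCompactSpace
  have : LocallyCompactSpace M := ChartedSpace.locallyCompactSpace H M
  have hB := fun x hx => SmoothBumpFunction.nhds_basis_support (I := I) (hU x hx)
  obtain ⟨ι, c, f, hf, hsub', hfin⟩ :=
    refinement_of_locallyCompact_paracompact_of_nhds_basis_set hs hB
  choose hcs hfU using hf
  obtain ⟨V, hsV, hVc, hVf⟩ := exists_subset_iUnion_closed_subset hs
    (fun i => (f i).isOpen_support) (fun x _ => hfin.point_finite x) hsub'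
  choose r hrR hr using fun i => (f i).exists_r_pos_lt_subset_ball (hVc i) (hVf i)
  refine ⟨ι, ⟨c, fun i => (f i).updateRIn (r i) (hrR i), hcs, ?_, fun x hx => ?_⟩, fun i => ?_⟩
  · simpa only [SmoothBumpFunction.support_updateRIn]
  · refine (mem_iUnion.1 <| hsV hx).imp fun i hi => ?_
    exact ((f i).updateRIn _ _).eventuallyEq_one_of_dist_lt
      ((f i).support_subset_source <| hVf _ hi) (hr i hi).2
  · simpa only [SmoothBumpFunction.support_updateRIn, tsupport] using hfU i

theorem exists_contMDiff_zero_one_of_isClosed_of_paracompact {s t : Set M}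
    (hs : IsClosed s) (ht : IsClosed t) (hd : Disjoint s t) :
    ∃ f : C(M, ℝ), ContMDiff I 𝓘(ℝ) ∞ f ∧ EqOn f 0 s ∧ EqOn f 1 t ∧ ∀ x, f x ∈ Icc 0 1 := by
  have : ∀ x ∈ t, sᶜ ∈ 𝓝 x := fun x hx => hs.isOpen_compl.mem_nhds (disjoint_right.1 hd hx)
  obtain ⟨ι, f, hf⟩ := SmoothBumpCovering.exists_isSubordinate_of_paracompact I ht this
  set g := f.toSmoothPartitionOfUnity
  refine ⟨⟨_, g.contMDiff_sum.continuous⟩, g.contMDiff_sum, fun x hx => ?_, fun x => g.sum_eq_one,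
    fun x => ⟨g.sum_nonneg x, g.sum_le_one x⟩⟩
  suffices ∀ i, g i x = 0 by simp [this]
  refine fun i => f.toSmoothPartitionOfUnity_zero_of_zero ?_
  exact Function.notMem_support.1 (subset_compl_comm.1 (hf.support_subset i) hx)

theorem SmoothPartitionOfUnity.exists_isSubordinate_of_paracompact {ι : Type*} {s : Set M}
    (hs : IsClosed s) (U : ι → Set M) (ho : ∀ i, IsOpen (U i)) (hU : s ⊆ ⋃ i, U i) :
    ∃ f : SmoothPartitionOfUnity ι I M s, f.IsSubordinate U := by
  obtain ⟨f, hf, hfU⟩ := BumpCovering.exists_isSubordinate_of_prop (ContMDiff I 𝓘(ℝ) ∞)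
    (fun _ _ hs ht hd => exists_contMDiff_zero_one_of_isClosed_of_paracompact I hs ht hd) hs U ho hU
  exact ⟨f.toSmoothPartitionOfUnity hf, hfU.toSmoothPartitionOfUnity hf⟩

end Partition

/-! ### Continuous and smooth families of linear maps between fibres. -/

namespace SmoothVectorBundle

variable {𝕜 : Type*} [RCLike 𝕜] {V : Type*} [NormedAddCommGroup V] [NormedSpace ℝ V]
  [NormedSpace 𝕜 V] [FiniteDimensional ℝ V]
  {B H : Type*} [NormedAddCommGroup B] [NormedSpace ℝ B] [TopologicalSpace H]
  {I : ModelWithCorners ℝ B H} {M : Type*} [TopologicalSpace M] [ChartedSpace H M]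
  (E : SmoothVectorBundle 𝕜 V I M)

/-- The preferred trivialization of `E` at `x`. -/
abbrev triv (x : M) : Trivialization V (π V E.Fiber) := trivializationAt V E.Fiber x

/-- The expression in the preferred trivializations at `x` and `y` of a linear map between the
fibres over `p` and `q`. -/
noncomputable def coord (x y p q : M) :
    (E.Fiber p →ₗ[𝕜] E.Fiber q) →ₗ[ℝ] (V →L[ℝ] V) where
  toFun T := LinearMap.toContinuousLinearMap
    ((E.triv y).linearMapAt ℝ q ∘ₗ T.restrictScalars ℝ ∘ₗ (E.triv x).symmₗ ℝ p)
  map_add' S T := by ext; simp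
  map_smul' c T := by ext; simp

variable {E} {x y z x' y' p q r : M}

theorem coord_apply (T : E.Fiber p →ₗ[𝕜] E.Fiber q) (u : V) :
    E.coord x y p q T u = (E.triv y).linearMapAt ℝ q (T ((E.triv x).symmₗ ℝ p u)) := rfl

theorem coord_linearMapAt (hp : p ∈ (E.triv x).baseSet) (T : E.Fiber p →ₗ[𝕜] E.Fiber q)
    (v : E.Fiber p) :
    E.coord x y p q T ((E.triv x).linearMapAt ℝ p v) = (E.triv y).linearMapAt ℝ q (T v) := by
  rw [coord_apply, Trivialization.symmₗ_linearMapAt _ hp]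

theorem coord_comp (hq : q ∈ (E.triv y).baseSet) (S : E.Fiber q →ₗ[𝕜] E.Fiber r)
    (T : E.Fiber p →ₗ[𝕜] E.Fiber q) :
    E.coord x z p r (S ∘ₗ T) = (E.coord y z q r S).comp (E.coord x y p q T) := by
  ext u
  simp only [ContinuousLinearMap.comp_apply, coord_apply, LinearMap.comp_apply]
  rw [Trivialization.symmₗ_linearMapAt _ hq]

theorem coord_id (hp : p ∈ (E.triv x).baseSet) :
    E.coord x x p p LinearMap.id = ContinuousLinearMap.id ℝ V := by
  ext u
  simp only [coord_apply, LinearMap.id_apply, ContinuousLinearMap.id_apply]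
  rw [Trivialization.linearMapAt_symmₗ _ hp]

theorem coordChangeL_eq_coord (hp : p ∈ (E.triv x).baseSet) (hp' : p ∈ (E.triv y).baseSet) :
    ((E.triv x).coordChangeL ℝ (E.triv y) p : V →L[ℝ] V) = E.coord x y p p LinearMap.id := by
  ext u
  rw [ContinuousLinearEquiv.coe_coe, Trivialization.coordChangeL_apply _ _ ⟨hp, hp'⟩, coord_apply,
    Trivialization.coe_linearMapAt_of_mem _ hp', Trivialization.coe_symmₗ _ hp]
  rfl

theorem coord_change (hp : p ∈ (E.triv x).baseSet) (hp' : p ∈ (E.triv x').baseSet)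
    (hq : q ∈ (E.triv y).baseSet) (hq' : q ∈ (E.triv y').baseSet)
    (T : E.Fiber p →ₗ[𝕜] E.Fiber q) :
    E.coord x' y' p q T = ((E.triv y).coordChangeL ℝ (E.triv y') q : V →L[ℝ] V).comp
      ((E.coord x y p q T).comp ((E.triv x').coordChangeL ℝ (E.triv x) p : V →L[ℝ] V)) := by
  rw [coordChangeL_eq_coord hq hq', coordChangeL_eq_coord hp' hp, ← coord_comp hp, ← coord_comp hq]
  rfl

theorem injective_coord_iff (hp : p ∈ (E.triv x).baseSet) (hq : q ∈ (E.triv y).baseSet)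
    {T : E.Fiber p →ₗ[𝕜] E.Fiber q} :
    Function.Injective (E.coord x y p q T) ↔ Function.Injective T := by
  have h1 : Function.Bijective ((E.triv x).symmₗ ℝ p) :=
    Function.bijective_iff_has_inverse.2 ⟨(E.triv x).linearMapAt ℝ p,
      Trivialization.linearMapAt_symmₗ _ hp, Trivialization.symmₗ_linearMapAt _ hp⟩
  have h2 : Function.Injective ((E.triv y).linearMapAt ℝ q) :=
    Function.LeftInverse.injective (Trivialization.symmₗ_linearMapAt _ hq)
  have : ⇑(E.coord x y p q T) = (E.triv y).linearMapAt ℝ q ∘ T ∘ (E.triv x).symmₗ ℝ p := rfl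
  rw [this, h2.of_comp_iff, Function.Injective.of_comp_iff' _ h1]

omit [FiniteDimensional ℝ V] in
theorem mem_baseSet_triv (x : M) : x ∈ (E.triv x).baseSet :=
  FiberBundle.mem_baseSet_trivializationAt' x

omit [FiniteDimensional ℝ V] in
theorem eventually_mem_baseSet {A : Type*} [TopologicalSpace A] {f : A → M} {a₀ : A}
    (hf : ContinuousAt f a₀) (h : f a₀ ∈ (E.triv x).baseSet) :
    ∀ᶠ a in 𝓝 a₀, f a ∈ (E.triv x).baseSet :=
  hf.eventually ((E.triv x).open_baseSet.mem_nhds h)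

section Continuous

variable {A : Type*} [TopologicalSpace A] {f g h : A → M} {a₀ : A}

variable (E) in
/-- Continuity at a point of a family of linear maps between fibres of `E`. -/
def ContinuousHomAt (f g : A → M) (φ : ∀ a, E.Fiber (f a) →ₗ[𝕜] E.Fiber (g a)) (a₀ : A) : Prop :=
  ContinuousAt (fun a => E.coord (f a₀) (g a₀) (f a) (g a) (φ a)) a₀

/-- Changing trivializations multiplies the coordinate expression on both sides by coordinate
changes, which depend continuously on the point; so continuity can be tested in any trivializations.
-/
theorem continuousAt_coord_of_continuousAt {φ : ∀ a, E.Fiber (f a) →ₗ[𝕜] E.Fiber (g a)}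
    (hf : ContinuousAt f a₀) (hg : ContinuousAt g a₀)
    (hx : f a₀ ∈ (E.triv x).baseSet) (hy : g a₀ ∈ (E.triv y).baseSet)
    (hx' : f a₀ ∈ (E.triv x').baseSet) (hy' : g a₀ ∈ (E.triv y').baseSet)
    (hφ : ContinuousAt (fun a => E.coord x y (f a) (g a) (φ a)) a₀) :
    ContinuousAt (fun a => E.coord x' y' (f a) (g a) (φ a)) a₀ := by
  have h1 : ContinuousAt
      (fun a => ((E.triv y).coordChangeL ℝ (E.triv y') (g a) : V →L[ℝ] V)) a₀ :=
    ContinuousAt.comp (f := g) (x := a₀)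
      (contMDiffAt_coordChangeL (IB := I) (n := ∞) hy hy').continuousAt hg
  have h2 : ContinuousAt
      (fun a => ((E.triv x').coordChangeL ℝ (E.triv x) (f a) : V →L[ℝ] V)) a₀ :=
    ContinuousAt.comp (f := f) (x := a₀)
      (contMDiffAt_coordChangeL (IB := I) (n := ∞) hx' hx).continuousAt hf
  refine (h1.clm_comp (hφ.clm_comp h2)).congr ?_
  filter_upwards [eventually_mem_baseSet hf hx, eventually_mem_baseSet hg hy,
    eventually_mem_baseSet hf hx', eventually_mem_baseSet hg hy'] with a h1 h2 h3 h4
  exact (coord_change h1 h3 h2 h4 _).symm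

theorem ContinuousHomAt.continuousAt_coord {φ : ∀ a, E.Fiber (f a) →ₗ[𝕜] E.Fiber (g a)}
    (hφ : E.ContinuousHomAt f g φ a₀) (hf : ContinuousAt f a₀) (hg : ContinuousAt g a₀)
    (hx : f a₀ ∈ (E.triv x).baseSet) (hy : g a₀ ∈ (E.triv y).baseSet) :
    ContinuousAt (fun a => E.coord x y (f a) (g a) (φ a)) a₀ :=
  continuousAt_coord_of_continuousAt hf hg (mem_baseSet_triv _) (mem_baseSet_triv _) hx hy hφ

theorem ContinuousHomAt.comp {φ : ∀ a, E.Fiber (f a) →ₗ[𝕜] E.Fiber (g a)}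
    {ψ : ∀ a, E.Fiber (g a) →ₗ[𝕜] E.Fiber (h a)}
    (hψ : E.ContinuousHomAt g h ψ a₀) (hφ : E.ContinuousHomAt f g φ a₀) (hg : ContinuousAt g a₀) :
    E.ContinuousHomAt f h (fun a => ψ a ∘ₗ φ a) a₀ := by
  refine (ContinuousAt.clm_comp hψ hφ).congr ?_
  filter_upwards [eventually_mem_baseSet hg (mem_baseSet_triv (E := E) _)] with a h1
  exact (coord_comp h1 _ _).symm

theorem ContinuousHomAt.comp_continuousAt {A' : Type*} [TopologicalSpace A'] {k : A' → A}
    {b₀ : A'} {φ : ∀ a, E.Fiber (f a) →ₗ[𝕜] E.Fiber (g a)}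
    (hφ : E.ContinuousHomAt f g φ (k b₀)) (hk : ContinuousAt k b₀) :
    E.ContinuousHomAt (fun b => f (k b)) (fun b => g (k b)) (fun b => φ (k b)) b₀ :=
  ContinuousAt.comp (f := k) (x := b₀) hφ hk

theorem ContinuousHomAt.eventually_injective {φ : ∀ a, E.Fiber (f a) →ₗ[𝕜] E.Fiber (g a)}
    (hφ : E.ContinuousHomAt f g φ a₀) (hf : ContinuousAt f a₀) (hg : ContinuousAt g a₀)
    (hinj : Function.Injective (φ a₀)) : ∀ᶠ a in 𝓝 a₀, Function.Injective (φ a) := by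
  have := Filter.Tendsto.eventually hφ ((ContinuousLinearMap.isOpen_injective).mem_nhds
    ((injective_coord_iff (mem_baseSet_triv _) (mem_baseSet_triv _)).2 hinj))
  filter_upwards [this, eventually_mem_baseSet hf (mem_baseSet_triv (E := E) _),
    eventually_mem_baseSet hg (mem_baseSet_triv (E := E) _)] with a h1 h2 h3
  exact (injective_coord_iff h2 h3).1 h1

end Continuous

section ContMDiff

variable {BA HA : Type*} [NormedAddCommGroup BA] [NormedSpace ℝ BA]
  [TopologicalSpace HA] {J : ModelWithCorners ℝ BA HA} {A : Type*} [TopologicalSpace A]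
  [ChartedSpace HA A] {f g : A → M} {a₀ : A}

variable (E J) in
/-- Smoothness at a point of a family of linear maps between fibres of `E`. -/
def ContMDiffHomAt (f g : A → M) (φ : ∀ a, E.Fiber (f a) →ₗ[𝕜] E.Fiber (g a)) (a₀ : A) : Prop :=
  ContMDiffAt J 𝓘(ℝ, V →L[ℝ] V) ∞ (fun a => E.coord (f a₀) (g a₀) (f a) (g a) (φ a)) a₀

theorem contMDiffAt_coord_of_contMDiffAt {φ : ∀ a, E.Fiber (f a) →ₗ[𝕜] E.Fiber (g a)}
    (hf : ContMDiffAt J I ∞ f a₀) (hg : ContMDiffAt J I ∞ g a₀)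
    (hx : f a₀ ∈ (E.triv x).baseSet) (hy : g a₀ ∈ (E.triv y).baseSet)
    (hx' : f a₀ ∈ (E.triv x').baseSet) (hy' : g a₀ ∈ (E.triv y').baseSet)
    (hφ : ContMDiffAt J 𝓘(ℝ, V →L[ℝ] V) ∞ (fun a => E.coord x y (f a) (g a) (φ a)) a₀) :
    ContMDiffAt J 𝓘(ℝ, V →L[ℝ] V) ∞ (fun a => E.coord x' y' (f a) (g a) (φ a)) a₀ := by
  have h1 := hg.coordChangeL hy hy'
  have h2 := hf.coordChangeL hx' hx
  refine (h1.clm_comp (hφ.clm_comp h2)).congr_of_eventuallyEq ?_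
  filter_upwards [eventually_mem_baseSet hf.continuousAt hx,
    eventually_mem_baseSet hg.continuousAt hy, eventually_mem_baseSet hf.continuousAt hx',
    eventually_mem_baseSet hg.continuousAt hy'] with a h1 h2 h3 h4
  exact coord_change h1 h3 h2 h4 _

theorem ContMDiffHomAt.contMDiffAt_coord {φ : ∀ a, E.Fiber (f a) →ₗ[𝕜] E.Fiber (g a)}
    (hφ : E.ContMDiffHomAt J f g φ a₀) (hf : ContMDiffAt J I ∞ f a₀) (hg : ContMDiffAt J I ∞ g a₀)
    (hx : f a₀ ∈ (E.triv x).baseSet) (hy : g a₀ ∈ (E.triv y).baseSet) :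
    ContMDiffAt J 𝓘(ℝ, V →L[ℝ] V) ∞ (fun a => E.coord x y (f a) (g a) (φ a)) a₀ :=
  contMDiffAt_coord_of_contMDiffAt hf hg (mem_baseSet_triv _) (mem_baseSet_triv _) hx hy hφ

theorem ContMDiffHomAt.continuousHomAt {φ : ∀ a, E.Fiber (f a) →ₗ[𝕜] E.Fiber (g a)}
    (hφ : E.ContMDiffHomAt J f g φ a₀) : E.ContinuousHomAt f g φ a₀ :=
  ContMDiffAt.continuousAt hφ

/-- Families of linear maps between fibres of `E` subject to a convex condition at each point can
be glued smoothly. -/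
theorem exists_contMDiffHomAt_forall_mem_convex_of_local [FiniteDimensional ℝ BA]
    [IsManifold J ∞ A] [T2Space A] [ParacompactSpace A]
    (t : ∀ a, Set (E.Fiber (f a) →ₗ[𝕜] E.Fiber (g a)))
    (ht : ∀ a, Convex ℝ (t a))
    (hloc : ∀ a₀, ∃ φ : ∀ a, E.Fiber (f a) →ₗ[𝕜] E.Fiber (g a),
      ∀ᶠ a in 𝓝 a₀, E.ContMDiffHomAt J f g φ a ∧ φ a ∈ t a) :
    ∃ φ : ∀ a, E.Fiber (f a) →ₗ[𝕜] E.Fiber (g a),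
      ∀ a, E.ContMDiffHomAt J f g φ a ∧ φ a ∈ t a := by
  choose φ hφ using hloc
  choose U hU hUo haU using fun a₀ => eventually_nhds_iff.1 (hφ a₀)
  obtain ⟨ρ, hρ⟩ := SmoothPartitionOfUnity.exists_isSubordinate_of_paracompact J isClosed_univ U hUo
    fun a _ => mem_iUnion.2 ⟨a, haU a⟩
  refine ⟨fun a => ∑ᶠ i, ρ i a • φ i a, fun a => ⟨?_, ?_⟩⟩
  -- Near `a` only the finitely many indices in `ρ.fintsupport a` contribute, and linearity of
  -- `coord` turns the glued family into a finite sum of smooth expressions.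
  · have h1 : ContMDiffAt J 𝓘(ℝ, V →L[ℝ] V) ∞ (fun b => ∑ i ∈ ρ.fintsupport a,
        ρ i b • E.coord (f a) (g a) (f b) (g b) (φ i b)) a := by
      refine ContMDiffAt.sum fun i hi => ?_
      exact (ρ i).contMDiff.contMDiffAt.smul
        (hU i a (hρ i ((ρ.mem_fintsupport_iff a i).1 hi))).1
    refine h1.congr_of_eventuallyEq ?_
    filter_upwards [ρ.eventually_finsupport_subset a] with b hb
    rw [finsum_eq_sum_of_support_subset (s := ρ.fintsupport a), map_sum]
    · simp only [map_smul]
    · refine Subset.trans ?_ (Finset.coe_subset.2 hb)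
      intro i hi
      simp only [Function.mem_support, SmoothPartitionOfUnity.coe_finsupport] at hi ⊢
      exact fun h0 => hi (by rw [h0, zero_smul])
  · exact (ht a).finsum_mem (ρ.nonneg · a) (ρ.sum_eq_one (mem_univ a))
      fun i hi => (hU i a (hρ i (subset_closure hi))).2

end ContMDiff

end SmoothVectorBundle

/-! ### Transport of fibres along a homotopy. -/

namespace SmoothVectorBundle

variable {𝕜 : Type*} [RCLike 𝕜] {V : Type*} [NormedAddCommGroup V] [NormedSpace ℝ V]
  [NormedSpace 𝕜 V] [IsScalarTower ℝ 𝕜 V] [FiniteDimensional ℝ V]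
  {B H : Type*} [NormedAddCommGroup B] [NormedSpace ℝ B] [TopologicalSpace H]
  {I : ModelWithCorners ℝ B H} {M : Type*} [TopologicalSpace M] [ChartedSpace H M]
  (E : SmoothVectorBundle 𝕜 V I M)

/-- The linear map between the fibres over `p` and `q` whose expression in the preferred
trivializations at `x` and `y` is `L`. -/
noncomputable def localHom (x y p q : M) (L : V →ₗ[𝕜] V) : E.Fiber p →ₗ[𝕜] E.Fiber q :=
  (E.triv y).symmₗ 𝕜 q ∘ₗ L ∘ₗ (E.triv x).linearMapAt 𝕜 p

variable {E} {x y p q : M}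

theorem coord_localHom (hp : p ∈ (E.triv x).baseSet) (hq : q ∈ (E.triv y).baseSet)
    (L : V →ₗ[𝕜] V) :
    E.coord x y p q (E.localHom x y p q L) =
      LinearMap.toContinuousLinearMap (L.restrictScalars ℝ) := by
  ext u
  have h1 : (E.triv x).linearMapAt 𝕜 p ((E.triv x).symmₗ ℝ p u) = u := by
    rw [Trivialization.coe_symmₗ _ hp, Trivialization.linearMapAt_symm _ hp]
  have h2 (v : V) : (E.triv y).linearMapAt ℝ q ((E.triv y).symmₗ 𝕜 q v) = v := by
    rw [Trivialization.coe_symmₗ _ hq, Trivialization.linearMapAt_symm _ hq]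
  simp only [coord_apply, localHom, LinearMap.comp_apply]
  rw [h1, h2]
  rfl

omit [IsScalarTower ℝ 𝕜 V] [FiniteDimensional ℝ V] in
theorem localHom_id_self (hp : p ∈ (E.triv x).baseSet) :
    E.localHom x x p p LinearMap.id = LinearMap.id := by
  ext v
  exact Trivialization.symmₗ_linearMapAt _ hp v

theorem contMDiffHomAt_localHom {BA HA : Type*} [NormedAddCommGroup BA] [NormedSpace ℝ BA]
    [TopologicalSpace HA] {J : ModelWithCorners ℝ BA HA} {A : Type*} [TopologicalSpace A]
    [ChartedSpace HA A] {f g : A → M} {a₀ : A} (hf : ContMDiffAt J I ∞ f a₀)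
    (hg : ContMDiffAt J I ∞ g a₀) (hx : f a₀ ∈ (E.triv x).baseSet)
    (hy : g a₀ ∈ (E.triv y).baseSet) (L : V →ₗ[𝕜] V) :
    E.ContMDiffHomAt J f g (fun a => E.localHom x y (f a) (g a) L) a₀ := by
  refine contMDiffAt_coord_of_contMDiffAt hf hg hx hy (mem_baseSet_triv _) (mem_baseSet_triv _) ?_
  refine (contMDiffAt_const (c := LinearMap.toContinuousLinearMap
    (L.restrictScalars ℝ))).congr_of_eventuallyEq ?_
  filter_upwards [eventually_mem_baseSet hf.continuousAt hx,
    eventually_mem_baseSet hg.continuousAt hy] with a h1 h2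
  exact coord_localHom h1 h2 L

variable [FiniteDimensional ℝ B] [IsManifold I ∞ M] [T2Space M]

variable (E) in
/-- There is a continuous family of linear maps between all pairs of fibres of a vector bundle
which is the identity on the diagonal. -/
theorem exists_continuousHomAt_eq_id_on_diagonal [ParacompactSpace (M × M)] :
    ∃ T : ∀ p q, E.Fiber p →ₗ[𝕜] E.Fiber q, (∀ p, T p p = LinearMap.id) ∧
      ∀ a : M × M, E.ContinuousHomAt Prod.fst Prod.snd (fun a => T a.1 a.2) a := by
  -- An affine condition on the diagonal and no condition off it; as the diagonal is closed, the
  -- zero map serves locally off it.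
  let t : ∀ a : M × M, Set (E.Fiber a.1 →ₗ[𝕜] E.Fiber a.2) :=
    fun a => {S | ∀ h : a.1 = a.2, ∀ v, S v = h ▸ v}
  have ht : ∀ a, Convex ℝ (t a) := by
    rintro ⟨p, q⟩ S hS S' hS' a b - - hab h v
    have h1 := hS h v
    have h2 := hS' h v
    obtain rfl : p = q := h
    simp only at h1 h2
    rw [LinearMap.add_apply, LinearMap.smul_apply, LinearMap.smul_apply, h1, h2, ← add_smul, hab,
      one_smul]
  have hloc : ∀ a₀, ∃ φ : ∀ a : M × M, E.Fiber a.1 →ₗ[𝕜] E.Fiber a.2,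
      ∀ᶠ a in 𝓝 a₀, E.ContMDiffHomAt (I.prod I) Prod.fst Prod.snd φ a ∧ φ a ∈ t a := by
    rintro ⟨p, q⟩
    by_cases hpq : p = q
    · subst hpq
      refine ⟨fun a => E.localHom p p a.1 a.2 LinearMap.id, ?_⟩
      filter_upwards [eventually_mem_baseSet (E := E) (a₀ := (p, p)) continuousAt_fst
        (mem_baseSet_triv p), eventually_mem_baseSet (E := E) (a₀ := (p, p)) continuousAt_snd
        (mem_baseSet_triv p)] with a h1 h2
      refine ⟨contMDiffHomAt_localHom contMDiffAt_fst contMDiffAt_snd h1 h2 _, fun h v => ?_⟩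
      obtain ⟨a, b⟩ := a
      obtain rfl : a = b := h
      exact LinearMap.congr_fun (localHom_id_self h1) v
    · refine ⟨fun a => 0, ?_⟩
      filter_upwards [(isOpen_ne_fun continuous_fst continuous_snd).mem_nhds
        (show (p, q).1 ≠ (p, q).2 from hpq)] with a ha
      refine ⟨?_, fun h => (ha h).elim⟩
      unfold ContMDiffHomAt
      simp only [map_zero]
      exact contMDiffAt_const
  obtain ⟨φ, hφ⟩ := exists_contMDiffHomAt_forall_mem_convex_of_local t ht hloc
  refine ⟨fun p q => φ (p, q), fun p => ?_, fun a => (hφ a).1.continuousHomAt⟩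
  ext v
  exact (hφ (p, p)).2 rfl v

/-- The fibres of a vector bundle along the paths of a homotopy which is stationary from time `1`
on can be continuously identified with the fibres at the endpoints. -/
theorem exists_continuousHomAt_injective_of_homotopy [ParacompactSpace M]
    [ParacompactSpace (M × M)] {c : ℝ → M → M} (hc : Continuous fun a : ℝ × M => c a.1 a.2)
    (hc0 : ∀ p, c 0 p = p) {r : M → M} (hc1 : ∀ s, 1 ≤ s → ∀ p, c s p = r p) :
    ∃ Φ : ∀ p, E.Fiber p →ₗ[𝕜] E.Fiber (r p),
      ∀ p, E.ContinuousHomAt (fun p => p) r Φ p ∧ Function.Injective (Φ p) := by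
  obtain ⟨T, hTid, hT⟩ := E.exists_continuousHomAt_eq_id_on_diagonal
  have hTinj : ∀ {p q : M}, p = q → Function.Injective (T p q) := by
    rintro p _ rfl
    rw [hTid]
    exact fun _ _ h => h
  have hTcomp : ∀ {p q : M} (z : M), p = q → T q z ∘ₗ T p q = T p z := by
    rintro p _ z rfl
    rw [hTid, LinearMap.comp_id]
  have hTc : ∀ {A : Type _} [TopologicalSpace A] {f g : A → M} {a : A}, ContinuousAt f a →
      ContinuousAt g a → E.ContinuousHomAt f g (fun a => T (f a) (g a)) a :=
    fun {A} _ {f g a} hf hg => (hT (f a, g a)).comp_continuousAt (k := fun a => (f a, g a))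
      (hf.prodMk hg)
  have hcc : ∀ {A : Type _} [TopologicalSpace A] {k : A → ℝ} {f : A → M}, Continuous k →
      Continuous f → Continuous fun a => c (k a) (f a) := fun hk hf => hc.comp (hk.prodMk hf)
  -- Quantifying over all `d' ≤ d` makes the set of admissible steps downward closed among positive
  -- reals, hence convex, so that a continuous choice of step exists.
  let t : M → Set ℝ := fun p => {d | 0 < d ∧ ∀ d' ∈ Icc 0 d, ∀ s ∈ Icc (0 : ℝ) 1,
    Function.Injective (T (c s p) (c (s + d') p))}
  have ht : ∀ p, Convex ℝ (t p) := fun p => by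
    refine Set.OrdConnected.convex ⟨?_⟩
    intro a ha b hb d hd
    exact ⟨ha.1.trans_le hd.1, fun d' hd' => hb.2 d' ⟨hd'.1, hd'.2.trans hd.2⟩⟩
  obtain ⟨δ, hδ⟩ := exists_continuous_forall_mem_convex_of_local_const ht fun p₀ => by
    have key : ∀ᶠ a : M × ℝ in 𝓝 (p₀, 0), ∀ s ∈ Icc (0 : ℝ) 1,
        Function.Injective (T (c s a.1) (c (s + a.2) a.1)) := by
      -- For `d' = 0` the two endpoints coincide and `T` is the identity; injectivity is open, and
      -- compactness of `[0, 1]` makes the neighbourhood uniform in `s`.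
      refine isCompact_Icc.eventually_forall_of_forall_eventually fun s _ => ?_
      have h1 : Continuous fun b : (M × ℝ) × ℝ => c b.2 b.1.1 :=
        hcc continuous_snd (continuous_fst.comp continuous_fst)
      have h2 : Continuous fun b : (M × ℝ) × ℝ => c (b.2 + b.1.2) b.1.1 :=
        hcc (continuous_snd.add (continuous_snd.comp continuous_fst))
          (continuous_fst.comp continuous_fst)
      refine (hTc (a := ((p₀, (0 : ℝ)), s)) h1.continuousAt h2.continuousAt).eventually_injective
        h1.continuousAt h2.continuousAt (hTinj ?_)
      simp
    rw [nhds_prod_eq] at key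
    obtain ⟨P, hP, Q, hQ, hPQ⟩ := eventually_prod_iff.1 key
    obtain ⟨ε, hε, hεQ⟩ := Metric.eventually_nhds_iff.1 hQ
    refine ⟨ε / 2, ?_⟩
    filter_upwards [hP] with p hp
    refine ⟨half_pos hε, fun d' hd' => hPQ hp (hεQ ?_)⟩
    rw [Real.dist_eq, sub_zero, abs_of_nonneg hd'.1]
    linarith [hd'.2]
  have hδc : ∀ n : ℕ, Continuous fun p => c (n * δ p) p := fun n =>
    hcc (continuous_const.mul δ.continuous) continuous_id
  -- Transport over `n` steps. It starts with `T p _` because `c (0 * δ p) p` equals `p` only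
  -- propositionally; this map is the identity up to that equality.
  let S : ∀ n : ℕ, ∀ p, E.Fiber p →ₗ[𝕜] E.Fiber (c (n * δ p) p) := fun n p =>
    Nat.rec (motive := fun n => E.Fiber p →ₗ[𝕜] E.Fiber (c ((n : ℕ) * δ p) p))
      (T p _) (fun n L => T _ _ ∘ₗ L) n
  have hS : ∀ (n : ℕ) p, S (n + 1) p = T _ _ ∘ₗ S n p := fun n p => rfl
  have hSc : ∀ (n : ℕ) p, E.ContinuousHomAt (fun p => p) (fun p => c (n * δ p) p) (S n) p := by
    intro n p
    induction n with
    | zero => exact hTc continuousAt_id (hδc 0).continuousAt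
    | succ n ih =>
      exact (hTc (hδc n).continuousAt (hδc (n + 1)).continuousAt).comp ih (hδc n).continuousAt
  have hSinj : ∀ (n : ℕ) p, Function.Injective (S n p) := by
    intro n p
    induction n with
    | zero => exact hTinj (by simp [hc0])
    | succ n ih =>
      rw [hS, LinearMap.coe_comp]
      refine Function.Injective.comp ?_ ih
      have hpos := (hδ p).1
      have hn : (0 : ℝ) ≤ n * δ p := by positivity
      -- Before time `1` the choice of `δ` applies; afterwards both endpoints are `r p`.
      rcases le_total (n * δ p) 1 with h | h
      · have := (hδ p).2 (δ p) ⟨hpos.le, le_rfl⟩ (n * δ p) ⟨hn, h⟩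
        have he : n * δ p + δ p = ((n + 1 : ℕ) : ℝ) * δ p := by push_cast; ring
        rwa [he] at this
      · refine hTinj ?_
        rw [hc1 _ h, hc1]
        push_cast
        nlinarith
  let Φ : ℕ → ∀ p, E.Fiber p →ₗ[𝕜] E.Fiber (r p) := fun n p => T _ _ ∘ₗ S n p
  -- Steps taken after time `1` do not move the point, so the number of steps no longer matters.
  have hΦ : ∀ {n m : ℕ} {p}, 1 ≤ n * δ p → n ≤ m → Φ m p = Φ n p := by
    intro n m p h hnm
    induction m, hnm using Nat.le_induction with
    | base => rfl
    | succ m hm ih =>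
      have hpos := (hδ p).1
      have hm' : (n : ℝ) ≤ m := by exact_mod_cast hm
      have h1 : 1 ≤ m * δ p := h.trans (by gcongr)
      have h2 : 1 ≤ ((m + 1 : ℕ) : ℝ) * δ p := by push_cast; nlinarith
      rw [← ih]
      change T _ _ ∘ₗ S (m + 1) p = T _ _ ∘ₗ S m p
      rw [hS, ← LinearMap.comp_assoc, hTcomp _ ((hc1 _ h1 p).trans (hc1 _ h2 p).symm)]
  -- The strict inequality is open in `p`: `N p` steps also suffice at nearby points, which gives
  -- continuity although `N` itself may jump.
  have hN : ∀ p, ∃ n : ℕ, 1 < n * δ p := fun p => by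
    obtain ⟨n, hn⟩ := exists_nat_gt (1 / δ p)
    exact ⟨n, by rwa [div_lt_iff₀ (hδ p).1] at hn⟩
  choose N hN using hN
  have hr : Continuous r := by
    have : r = fun p => c 1 p := funext fun p => (hc1 1 le_rfl p).symm
    rw [this]
    exact hcc continuous_const continuous_id
  refine ⟨fun p => Φ (N p) p, fun p => ⟨?_, ?_⟩⟩
  · have h1 : E.ContinuousHomAt (fun p => p) r (Φ (N p)) p :=
      (hTc (hδc _).continuousAt hr.continuousAt).comp (hSc _ p) (hδc _).continuousAt
    refine ContinuousAt.congr h1 ?_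
    filter_upwards [(continuous_const.mul δ.continuous).continuousAt.eventually
      (lt_mem_nhds (hN p))] with q hq
    have : Φ (N p) q = Φ (N q) q := by
      rcases le_total (N p) (N q) with h | h
      · exact (hΦ hq.le h).symm
      · exact hΦ (hN q).le h
    rw [this]
  · change Function.Injective (T _ _ ∘ₗ S (N p) p)
    rw [LinearMap.coe_comp]
    exact (hTinj (hc1 _ (hN p).le p)).comp (hSinj _ p)

end SmoothVectorBundle

/-! ### Smooth approximation of injective families. -/

theorem ContinuousLinearMap.eventually_norm_sub_lt {X V W : Type*} [TopologicalSpace X]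
    [NormedAddCommGroup V] [NormedSpace ℝ V] [FiniteDimensional ℝ V] [NormedAddCommGroup W]
    [NormedSpace ℝ W] {S T : X → V →L[ℝ] W} {x₀ : X} (hS : ContinuousAt S x₀)
    (hT : ContinuousAt T x₀) (h : S x₀ = T x₀) (hinj : Function.Injective (T x₀)) :
    ∀ᶠ x in 𝓝 x₀, ∀ u ≠ 0, ‖S x u - T x u‖ < ‖T x u‖ := by
  obtain ⟨K, hK, hKT⟩ := LinearMap.exists_antilipschitzWith (T x₀ : V →ₗ[ℝ] W)
    (LinearMap.ker_eq_bot.2 hinj)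
  have hK' : (0 : ℝ) < K := by exact_mod_cast hK
  -- With `‖T x₀ u‖ ≥ ‖u‖ / K` and both errors at most `‖u‖ / (3 * K)`, one has `‖T x u‖ ≥ 2 * ‖u‖ /
  -- (3 * K)`, which exceeds the error of `S x u`.
  have hε : (0 : ℝ) < (3 * K : ℝ)⁻¹ := by positivity
  have h1 : ∀ᶠ x in 𝓝 x₀, ‖S x - T x‖ < (3 * K : ℝ)⁻¹ := by
    have := (hS.sub hT).norm
    rw [ContinuousAt] at this
    simp only [Pi.sub_apply, h, sub_self, norm_zero] at this
    exact this.eventually (gt_mem_nhds hε)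
  have h2 : ∀ᶠ x in 𝓝 x₀, ‖T x₀ - T x‖ < (3 * K : ℝ)⁻¹ := by
    have := ((continuousAt_const (y := T x₀)).sub hT).norm
    rw [ContinuousAt] at this
    simp only [Pi.sub_apply, sub_self, norm_zero] at this
    exact this.eventually (gt_mem_nhds hε)
  filter_upwards [h1, h2] with x h1 h2 u hu
  have hu' : 0 < ‖u‖ := norm_pos_iff.2 hu
  have h3 : ‖S x u - T x u‖ ≤ (3 * K : ℝ)⁻¹ * ‖u‖ :=
    ((S x - T x).le_opNorm u).trans (by gcongr)
  have h4 : ‖T x₀ u - T x u‖ ≤ (3 * K : ℝ)⁻¹ * ‖u‖ :=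
    ((T x₀ - T x).le_opNorm u).trans (by gcongr)
  have h5 : ‖u‖ ≤ K * ‖T x₀ u‖ := by simpa using hKT.le_mul_dist u 0
  have h6 : ‖T x₀ u‖ ≤ ‖T x₀ u - T x u‖ + ‖T x u‖ := by
    simpa using norm_add_le (T x₀ u - T x u) (T x u)
  have h7 : 3 * ((3 * K : ℝ)⁻¹ * ‖u‖) ≤ ‖T x₀ u‖ := by
    rw [mul_inv, ← mul_assoc, ← mul_assoc, mul_inv_cancel₀ (by norm_num), one_mul,
      inv_mul_le_iff₀ hK']
    exact h5
  have h8 : 0 < (3 * K : ℝ)⁻¹ * ‖u‖ := by positivity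
  linarith

namespace SmoothVectorBundle

variable {𝕜 : Type*} [RCLike 𝕜] {V : Type*} [NormedAddCommGroup V] [NormedSpace ℝ V]
  [NormedSpace 𝕜 V]
  {B H : Type*} [NormedAddCommGroup B] [NormedSpace ℝ B] [TopologicalSpace H]
  {I : ModelWithCorners ℝ B H} {M : Type*} [TopologicalSpace M] [ChartedSpace H M]
  (E : SmoothVectorBundle 𝕜 V I M)

/-- One can choose a trivialization around each point such that only finitely many trivializations
are chosen near each point, all of which are defined at that point. -/
theorem exists_choice_triv [T2Space M] [ParacompactSpace M] :
    ∃ τ : M → M, (∀ q, q ∈ (E.triv (τ q)).baseSet) ∧ ∀ q₀, ∃ s : Finset M,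
      (∀ x ∈ s, q₀ ∈ (E.triv x).baseSet) ∧ ∀ᶠ q in 𝓝 q₀, τ q ∈ s := by
  obtain ⟨ρ, hρ⟩ := PartitionOfUnity.exists_isSubordinate isClosed_univ
    (fun x => (E.triv x).baseSet) (fun x => (E.triv x).open_baseSet)
    fun x _ => mem_iUnion.2 ⟨x, mem_baseSet_triv x⟩
  choose τ hτ using fun q => ρ.exists_pos (mem_univ q)
  refine ⟨τ, fun q => hρ _ (subset_closure (hτ q).ne'), fun q₀ => ⟨ρ.fintsupport q₀,
    fun x hx => hρ _ ((ρ.mem_fintsupport_iff _ _).1 hx), ?_⟩⟩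
  filter_upwards [ρ.eventually_finsupport_subset q₀] with q hq
  exact hq ((ρ.mem_finsupport _).2 (hτ q).ne')

variable {E} [IsScalarTower ℝ 𝕜 V] [FiniteDimensional ℝ V]

/-- A continuous family of injective linear maps between fibres can be approximated by a smooth
one. -/
theorem exists_contMDiffHomAt_injective_of_continuousHomAt [FiniteDimensional ℝ B]
    [IsManifold I ∞ M] [T2Space M] [ParacompactSpace M] {r : M → M} (hr : ContMDiff I I ∞ r)
    {Φ : ∀ p, E.Fiber p →ₗ[𝕜] E.Fiber (r p)} (hΦ : ∀ p, E.ContinuousHomAt (fun p => p) r Φ p)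
    (hinj : ∀ p, Function.Injective (Φ p)) :
    ∃ Ψ : ∀ p, E.Fiber p →ₗ[𝕜] E.Fiber (r p),
      ∀ p, E.ContMDiffHomAt I (fun p => p) r Ψ p ∧ Function.Injective (Ψ p) := by
  obtain ⟨τ, hτ, hτf⟩ := E.exists_choice_triv
  -- `L p` measures vectors of the fibre over `r p` by the norm of `V`. It need not vary
  -- continuously with `p`; locally only finitely many trivializations occur.
  let L : ∀ p, E.Fiber (r p) →ₗ[ℝ] V := fun p => (E.triv (τ (r p))).linearMapAt ℝ (r p)
  -- Convex because balls are, and every member is injective: the open ball of radius `‖w‖` about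
  -- `w` omits `0`.
  let t : ∀ p, Set (E.Fiber p →ₗ[𝕜] E.Fiber (r p)) := fun p =>
    {S | ∀ v ≠ 0, L p (S v) ∈ Metric.ball (L p (Φ p v)) ‖L p (Φ p v)‖}
  have ht : ∀ p, Convex ℝ (t p) := by
    intro p S hS S' hS' a b ha hb hab v hv
    have := convex_ball _ _ (hS v hv) (hS' v hv) ha hb hab
    simpa using this
  have hloc : ∀ p₀, ∃ φ : ∀ p, E.Fiber p →ₗ[𝕜] E.Fiber (r p),
      ∀ᶠ p in 𝓝 p₀, E.ContMDiffHomAt I (fun p => p) r φ p ∧ φ p ∈ t p := by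
    intro p₀
    -- The local approximation is constant in coordinates, with the value of `Φ` at `p₀`.
    let A : V →ₗ[𝕜] V :=
      (E.triv (r p₀)).linearMapAt 𝕜 (r p₀) ∘ₗ Φ p₀ ∘ₗ (E.triv p₀).symmₗ 𝕜 p₀
    let φ : ∀ p, E.Fiber p →ₗ[𝕜] E.Fiber (r p) := fun p => E.localHom p₀ (r p₀) p (r p) A
    have hφ₀ : φ p₀ = Φ p₀ := by
      ext v
      simp only [φ, localHom, A, LinearMap.comp_apply]
      rw [Trivialization.symmₗ_linearMapAt _ (mem_baseSet_triv _),
        Trivialization.symmₗ_linearMapAt _ (mem_baseSet_triv _)]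
    have hφ : ∀ᶠ p in 𝓝 p₀, E.ContMDiffHomAt I (fun p => p) r φ p := by
      filter_upwards [eventually_mem_baseSet (E := E) (f := fun p => p) continuousAt_id
        (mem_baseSet_triv p₀), eventually_mem_baseSet (E := E) hr.continuous.continuousAt
        (mem_baseSet_triv (r p₀))] with p h1 h2
      exact contMDiffHomAt_localHom contMDiffAt_id hr.contMDiffAt h1 h2 A
    obtain ⟨s, hs, hsτ⟩ := hτf (r p₀)
    have hlt : ∀ᶠ p in 𝓝 p₀, ∀ x ∈ s, ∀ u ≠ 0,
        ‖E.coord p₀ x p (r p) (φ p) u - E.coord p₀ x p (r p) (Φ p) u‖ <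
          ‖E.coord p₀ x p (r p) (Φ p) u‖ := by
      refine (Filter.eventually_all_finset s).2 fun x hx => ?_
      refine ContinuousLinearMap.eventually_norm_sub_lt
        (hφ.self_of_nhds.continuousHomAt.continuousAt_coord continuousAt_id
          hr.continuous.continuousAt (mem_baseSet_triv p₀) (hs x hx))
        ((hΦ p₀).continuousAt_coord continuousAt_id
          hr.continuous.continuousAt (mem_baseSet_triv p₀) (hs x hx)) (by rw [hφ₀]) ?_
      exact (injective_coord_iff (mem_baseSet_triv p₀) (hs x hx)).2 (hinj p₀)
    refine ⟨φ, ?_⟩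
    filter_upwards [hφ, hlt, hr.continuous.continuousAt.eventually hsτ,
      eventually_mem_baseSet (E := E) (f := fun p => p) continuousAt_id
        (mem_baseSet_triv p₀)] with p h1 h2 h3 h4
    refine ⟨h1, fun v hv => ?_⟩
    have hu : (E.triv p₀).linearMapAt ℝ p v ≠ 0 := fun h0 => hv <| by
      rw [← Trivialization.symmₗ_linearMapAt (R := ℝ) (E.triv p₀) h4 v, h0, map_zero]
    have := h2 _ h3 _ hu
    rw [coord_linearMapAt h4, coord_linearMapAt h4] at this
    rwa [Metric.mem_ball, dist_eq_norm]
  obtain ⟨Ψ, hΨ⟩ := exists_contMDiffHomAt_forall_mem_convex_of_local t ht hloc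
  refine ⟨Ψ, fun p => ⟨(hΨ p).1, (injective_iff_map_eq_zero _).2 fun v hv => ?_⟩⟩
  by_contra hne
  have := (hΨ p).2 v hne
  rw [hv, map_zero, Metric.mem_ball, dist_zero_left] at this
  exact this.false

omit [IsScalarTower ℝ 𝕜 V] in
theorem bijective_of_injective {p q : M} {T : E.Fiber p →ₗ[𝕜] E.Fiber q}
    (hT : Function.Injective T) : Function.Bijective T := by
  have hp := (E.triv p).linearEquivAt ℝ p (mem_baseSet_triv p)
  have hq := (E.triv q).linearEquivAt ℝ q (mem_baseSet_triv q)
  have := hp.symm.finiteDimensional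
  have := hq.symm.finiteDimensional
  exact ⟨hT, (LinearMap.injective_iff_surjective_of_finrank_eq_finrank
    (f := T.restrictScalars ℝ) (hp.finrank_eq.trans hq.finrank_eq.symm)).1 hT⟩

-- In coordinates the inverse family is the pointwise inverse of the given one, and inversion of
-- continuous linear maps is smooth at an invertible map.
omit [IsScalarTower ℝ 𝕜 V] in
theorem ContMDiffHomAt.symm {BA HA : Type*} [NormedAddCommGroup BA] [NormedSpace ℝ BA]
    [TopologicalSpace HA] {J : ModelWithCorners ℝ BA HA} {A : Type*} [TopologicalSpace A]
    [ChartedSpace HA A] {f g : A → M} {a₀ : A}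
    {Ψ : ∀ a, E.Fiber (f a) ≃ₗ[𝕜] E.Fiber (g a)}
    (hΨ : E.ContMDiffHomAt J f g (fun a => (Ψ a : E.Fiber (f a) →ₗ[𝕜] E.Fiber (g a))) a₀)
    (hf : ContinuousAt f a₀) (hg : ContinuousAt g a₀) :
    E.ContMDiffHomAt J g f (fun a => ((Ψ a).symm : E.Fiber (g a) →ₗ[𝕜] E.Fiber (f a))) a₀ := by
  have key : ∀ {p q x y : M} (hp : p ∈ (E.triv x).baseSet) (hq : q ∈ (E.triv y).baseSet)
      (S : E.Fiber p ≃ₗ[𝕜] E.Fiber q), ∃ C : V ≃L[ℝ] V,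
      (C : V →L[ℝ] V) = E.coord x y p q (S : E.Fiber p →ₗ[𝕜] E.Fiber q) ∧
      (C.symm : V →L[ℝ] V) = E.coord y x q p (S.symm : E.Fiber q →ₗ[𝕜] E.Fiber p) := by
    intro p q x y hp hq S
    have h1 := coord_comp (x := x) (z := x) hq (S.symm : E.Fiber q →ₗ[𝕜] E.Fiber p)
      (S : E.Fiber p →ₗ[𝕜] E.Fiber q)
    have h2 := coord_comp (x := y) (z := y) hp (S : E.Fiber p →ₗ[𝕜] E.Fiber q)
      (S.symm : E.Fiber q →ₗ[𝕜] E.Fiber p)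
    rw [LinearEquiv.symm_comp, coord_id hp] at h1
    rw [LinearEquiv.comp_symm, coord_id hq] at h2
    exact ⟨.equivOfInverse (E.coord x y p q S) (E.coord y x q p S.symm)
      (fun u => (DFunLike.congr_fun h1 u).symm) fun u => (DFunLike.congr_fun h2 u).symm, rfl, rfl⟩
  obtain ⟨C, hC, -⟩ := key (mem_baseSet_triv (E := E) (f a₀)) (mem_baseSet_triv (g a₀)) (Ψ a₀)
  have h1 : ContDiffAt ℝ ∞ ContinuousLinearMap.inverse
      (E.coord (f a₀) (g a₀) (f a₀) (g a₀) (Ψ a₀)) := by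
    rw [← hC]
    exact contDiffAt_map_inverse C
  refine (h1.contMDiffAt.comp a₀ hΨ).congr_of_eventuallyEq ?_
  filter_upwards [eventually_mem_baseSet hf (mem_baseSet_triv (E := E) _),
    eventually_mem_baseSet hg (mem_baseSet_triv (E := E) _)] with a ha hb
  obtain ⟨C, hC, hC'⟩ := key ha hb (Ψ a)
  rw [Function.comp_apply, ← hC, ← hC', ContinuousLinearMap.inverse_equiv]

end SmoothVectorBundle

/-! ### From a smooth family of isomorphisms to a semi-trivialization. -/

namespace SmoothVectorBundle

variable {𝕜 : Type*} [RCLike 𝕜] {V : Type*} [NormedAddCommGroup V] [NormedSpace ℝ V]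
  [NormedSpace 𝕜 V]
  {B H : Type*} [NormedAddCommGroup B] [NormedSpace ℝ B] [TopologicalSpace H]
  {I : ModelWithCorners ℝ B H} {M : Type*} [TopologicalSpace M] [ChartedSpace H M]
  {B' H' : Type*} [NormedAddCommGroup B'] [NormedSpace ℝ B'] [TopologicalSpace H']
  {I' : ModelWithCorners ℝ B' H'} {N : Type*} [TopologicalSpace N] [ChartedSpace H' N]

/-- The pullback of a smooth vector bundle under a smooth map. -/
noncomputable def pullback (E : SmoothVectorBundle.{w} 𝕜 V I M) (f : C^∞⟮I', N; I, M⟯) :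
    SmoothVectorBundle.{w} 𝕜 V I' N where
  Fiber := f *ᵖ E.Fiber
  addCommGroup x := E.addCommGroup (f x)
  module x := E.module (f x)
  realModule x := E.realModule (f x)
  isScalarTower x := E.isScalarTower (f x)
  topologicalSpaceFiber := inferInstance
  topologicalSpaceTotal := inferInstance
  fiberBundle := FiberBundle.pullback f
  vectorBundle := VectorBundle.pullback 𝕜 f
  realVectorBundle := VectorBundle.pullback ℝ f
  contMDiffVectorBundle := ContMDiffVectorBundle.pullback V E.Fiber I' f

theorem contMDiffAt_coord_total (E : SmoothVectorBundle.{w} 𝕜 V I M) (z : E.Total) :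
    ContMDiffAt (I.prod 𝓘(ℝ, V)) 𝓘(ℝ, V) ∞
      (fun z' : E.Total => (E.triv z.proj).linearMapAt ℝ z'.proj z'.2) z := by
  have h := (contMDiffAt_totalSpace.1 (contMDiffAt_id (I := I.prod 𝓘(ℝ, V)) (n := ∞) (x := z))).2
  refine h.congr_of_eventuallyEq ?_
  filter_upwards [eventually_mem_baseSet (E := E) (FiberBundle.continuous_proj V E.Fiber).continuousAt
    (mem_baseSet_triv z.proj)] with z' hz'
  rw [Trivialization.coe_linearMapAt_of_mem _ hz']
  rfl

variable [FiniteDimensional ℝ V]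

theorem linearMapAt_eq_coord (E : SmoothVectorBundle.{w} 𝕜 V I M) {x y p q : M}
    (hp : p ∈ (E.triv x).baseSet) (hq : q ∈ (E.triv y).baseSet)
    (T : E.Fiber p →ₗ[𝕜] E.Fiber q) (v : E.Fiber p) :
    (E.triv y ⟨q, T v⟩).2 = E.coord x y p q T ((E.triv x).linearMapAt ℝ p v) := by
  rw [coord_linearMapAt hp, Trivialization.coe_linearMapAt_of_mem _ hq]

/-- A smooth family of linear isomorphisms between the fibres of `E` over `p` and `(x₀, p.2)` is a
semi-trivialization. -/
theorem nonempty_semiTrivialization_of_contMDiffHomAt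
    {BX HX : Type*} [NormedAddCommGroup BX] [NormedSpace ℝ BX] [TopologicalSpace HX]
    {IX : ModelWithCorners ℝ BX HX} {X : Type*} [TopologicalSpace X] [ChartedSpace HX X]
    {BY HY : Type*} [NormedAddCommGroup BY] [NormedSpace ℝ BY] [TopologicalSpace HY]
    {IY : ModelWithCorners ℝ BY HY} {Y : Type*} [TopologicalSpace Y] [ChartedSpace HY Y]
    (E : SmoothVectorBundle.{w} 𝕜 V (IX.prod IY) (X × Y)) (x₀ : X)
    (Ψ : ∀ p : X × Y, E.Fiber p ≃ₗ[𝕜] E.Fiber (x₀, p.2))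
    (hΨ : ∀ p, E.ContMDiffHomAt (IX.prod IY) (fun p => p) (fun p => (x₀, p.2))
      (fun p => (Ψ p : E.Fiber p →ₗ[𝕜] E.Fiber (x₀, p.2))) p) :
    Nonempty (SemiTrivialization E
      (E.pullback (⟨fun y : Y => (x₀, y), contMDiff_const.prodMk contMDiff_id⟩ :
        C^∞⟮IY, Y; IX.prod IY, X × Y⟯))) := by
  set F := E.pullback (⟨fun y : Y => (x₀, y), contMDiff_const.prodMk contMDiff_id⟩ :
        C^∞⟮IY, Y; IX.prod IY, X × Y⟯)
  have hr : Continuous fun p : X × Y => (x₀, p.2) := continuous_const.prodMk continuous_snd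
  let toF : E.Total → X × F.Total := fun z => (z.proj.1, ⟨z.proj.2, Ψ z.proj z.2⟩)
  let toE : X × F.Total → E.Total := fun z =>
    ⟨(z.1, z.2.proj), (Ψ (z.1, z.2.proj)).symm z.2.2⟩
  have hproj : ContMDiff ((IX.prod IY).prod 𝓘(ℝ, V)) (IX.prod IY) ∞ (fun z : E.Total => z.proj) :=
    contMDiff_proj E.Fiber
  have hprojF : ContMDiff (IX.prod (IY.prod 𝓘(ℝ, V))) IY ∞ (fun z : X × F.Total => z.2.proj) :=
    (contMDiff_proj F.Fiber).comp contMDiff_snd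
  have hbase : ContMDiff (IX.prod (IY.prod 𝓘(ℝ, V))) (IX.prod IY) ∞
      (fun z : X × F.Total => (z.1, z.2.proj)) := contMDiff_fst.prodMk hprojF
  have htoF : ContMDiff ((IX.prod IY).prod 𝓘(ℝ, V)) (IX.prod (IY.prod 𝓘(ℝ, V))) ∞ toF := by
    refine (contMDiff_fst.comp hproj).prodMk fun z => contMDiffAt_totalSpace.2 ⟨?_, ?_⟩
    · exact (contMDiff_snd.comp hproj).contMDiffAt
    -- In trivializations the fibre component is the coordinate expression of `Ψ` applied to the
    -- coordinate of the vector.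
    · have h1 := ((hΨ z.proj).comp z hproj.contMDiffAt).clm_apply (contMDiffAt_coord_total E z)
      refine h1.congr_of_eventuallyEq ?_
      filter_upwards [eventually_mem_baseSet (E := E) hproj.continuous.continuousAt
        (mem_baseSet_triv z.proj), eventually_mem_baseSet (E := E)
        (hr.comp hproj.continuous).continuousAt (mem_baseSet_triv (x₀, z.proj.2))] with z' h1 h2
      exact linearMapAt_eq_coord E h1 h2
        (Ψ z'.proj : E.Fiber z'.proj →ₗ[𝕜] E.Fiber (x₀, z'.proj.2)) z'.2
  have htoE : ContMDiff (IX.prod (IY.prod 𝓘(ℝ, V))) ((IX.prod IY).prod 𝓘(ℝ, V)) ∞ toE := by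
    refine fun z => contMDiffAt_totalSpace.2 ⟨hbase.contMDiffAt, ?_⟩
    have h0 := (hΨ (z.1, z.2.proj)).symm continuousAt_id hr.continuousAt
    unfold ContMDiffHomAt at h0
    have h1 := (ContMDiffAt.comp (f := fun z : X × F.Total => (z.1, z.2.proj)) z h0
      hbase.contMDiffAt).clm_apply
      ((contMDiffAt_coord_total F z.2).comp z contMDiffAt_snd)
    refine h1.congr_of_eventuallyEq ?_
    filter_upwards [eventually_mem_baseSet (E := E) hbase.continuous.continuousAt
      (mem_baseSet_triv (z.1, z.2.proj)), eventually_mem_baseSet (E := E)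
      (hr.comp hbase.continuous).continuousAt (mem_baseSet_triv (x₀, z.2.proj))] with z' h1 h2
    have h3 := linearMapAt_eq_coord E h2 h1
      ((Ψ (z'.1, z'.2.proj)).symm : E.Fiber (x₀, z'.2.proj) →ₗ[𝕜] E.Fiber (z'.1, z'.2.proj)) z'.2.2
    refine h3.trans (congrArg _ ?_)
    -- The preferred trivialization of `F` at `y` is by definition the pullback of that of `E` at
    -- `(x₀, y)`.
    have h4 : z'.2.proj ∈ (F.triv z.2.proj).baseSet := h2
    change _ = (F.triv z.2.proj).linearMapAt ℝ z'.2.proj z'.2.2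
    rw [Trivialization.coe_linearMapAt_of_mem _ h4]
    exact congrFun (Trivialization.coe_linearMapAt_of_mem _ h2) _
  refine ⟨⟨⟨⟨toF, toE, fun z => ?_, fun z => ?_⟩, htoF, htoE⟩, Ψ,
    fun p v => rfl⟩⟩
  · exact congrArg (TotalSpace.mk z.proj) ((Ψ z.proj).symm_apply_apply z.2)
  · exact congrArg (fun v => (z.1, TotalSpace.mk z.2.proj v))
      ((Ψ (z.1, z.2.proj)).apply_symm_apply z.2.2)

end SmoothVectorBundle

/-! ### The main theorem. -/

theorem mainTheorem13
    {𝕜 : Type*} [RCLike 𝕜]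
    {V : Type*} [NormedAddCommGroup V] [NormedSpace ℝ V] [NormedSpace 𝕜 V]
    [IsScalarTower ℝ 𝕜 V] [FiniteDimensional 𝕜 V]
    {BX HX : Type*} [NormedAddCommGroup BX] [NormedSpace ℝ BX] [FiniteDimensional ℝ BX]
    [TopologicalSpace HX] {IX : ModelWithCorners ℝ BX HX}
    {X : Type*} [TopologicalSpace X] [ChartedSpace HX X] [IsManifold IX ∞ X]
    [T2Space X] [ParacompactSpace X]
    {BY HY : Type*} [NormedAddCommGroup BY] [NormedSpace ℝ BY] [FiniteDimensional ℝ BY]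
    [TopologicalSpace HY] {IY : ModelWithCorners ℝ BY HY}
    {Y : Type*} [TopologicalSpace Y] [ChartedSpace HY Y] [IsManifold IY ∞ Y]
    [T2Space Y] [ParacompactSpace Y]
    [ContractibleSpace X]
    (E : SmoothVectorBundle.{w} 𝕜 V (IX.prod IY) (X × Y)) :
    E.IsTrivialWithRespectToFst := by
  have : FiniteDimensional ℝ V := FiniteDimensional.trans ℝ 𝕜 V
  have : LocallyCompactSpace HX := IX.locallyCompactSpace
  have : LocallyCompactSpace X := ChartedSpace.locallyCompactSpace HX X
  have : LocallyCompactSpace HY := IY.locallyCompactSpace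
  have : LocallyCompactSpace Y := ChartedSpace.locallyCompactSpace HY Y
  have : ParacompactSpace (X × Y) := .prod_of_locallyCompact X Y
  have : ParacompactSpace ((X × Y) × (X × Y)) := .prod_of_locallyCompact _ _
  obtain ⟨x₀, ⟨G⟩⟩ := id_nullhomotopic X
  -- Clamping time to `[0, 1]` makes the homotopy stationary from time `1` on, so transport may
  -- overshoot the endpoint.
  let c : ℝ → X × Y → X × Y := fun s p => (G (projIcc 0 1 zero_le_one s, p.1), p.2)
  have hc : Continuous fun a : ℝ × (X × Y) => c a.1 a.2 := by
    have := (continuous_projIcc (a := (0 : ℝ)) (b := 1) (h := zero_le_one))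
    fun_prop
  obtain ⟨Φ, hΦ⟩ := SmoothVectorBundle.exists_continuousHomAt_injective_of_homotopy (E := E) hc
    (r := fun p => (x₀, p.2)) (fun p => by simp [c]) fun s hs p => by
      simp only [c, projIcc_of_right_le _ hs]
      exact Prod.ext (G.apply_one p.1) rfl
  obtain ⟨Ψ, hΨ⟩ := SmoothVectorBundle.exists_contMDiffHomAt_injective_of_continuousHomAt
    (contMDiff_const.prodMk contMDiff_snd) (fun p => (hΦ p).1) fun p => (hΦ p).2
  exact ⟨_, SmoothVectorBundle.nonempty_semiTrivialization_of_contMDiffHomAt E x₀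
    (fun p => .ofBijective (Ψ p) (SmoothVectorBundle.bijective_of_injective (hΨ p).2))
    fun p => (hΨ p).1⟩
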